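/- Let $n\ge 3$ and $\phi=X^n+XY^2+Z^2\in\mathbb C[X,Y,Z]$. Grade $\mathbb C[X,Y,Z]$ by $\deg X=4$, $\deg Y=2n-2$, $\deg Z=2n$, and equip it with the Poisson bracket $\{\cdot,\cdot\}_\phi$, of degree $-2$, determined by $\{X,Y\}_\phi=\partial\phi/\partial Z$, $\{X,Z\}_\phi=-\partial\phi/\partial Y$, $\{Y,Z\}_\phi=\partial\phi/\partial X$. A noncommutative deformation of $(\mathbb C[X,Y,Z],\{\cdot,\cdot\}_\phi)$ is an associative unital $\mathbb C$-algebra $A$ with an exhaustive algebra filtration $A_0\subseteq A_1\subseteq A_2\subseteq\cdots$ and an isomorphism of graded algebras $\operatorname{gr}A=\bigoplus_i A_i/A_{i-1}\cong\mathbb C[X,Y,Z]$ (with $A_{-1}=0$) such that, for $a\in A_i$ and $b\in A_j$ with $i+j\ge 2$, one has $[a,b]=ab-ba\in A_{i+j-2}$, and the class of $[a,b]$ in degree $i+j-2$ corresponds to $\{\bar a,\bar b\}_\phi$, where $\bar a,\bar b\in\mathbb C[X,Y,Z]$ correspond to the classes of $a$ and $b$ in degrees $i$ and $j$. For $P\in\mathbb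 C[t]$ of degree $n-1$ and $\gamma\in\mathbb C$, let $H(P,\gamma)$ be the associative $\mathbb C$-algebra with generators $U,V,W$ and relations $$[U,V]=2W,\qquad [U,W]=-2UV+2W+\gamma,\qquad [V,W]=V^2+P(U),$$ filtered so that degree $\le d$ is spanned by the monomials $U^iV^jW^k$ with $4i+(2n-2)j+2nk\le d$. Lemma. Let $A$ be a noncommutative deformation of $(\mathbb C[X,Y,Z],\{\cdot,\cdot\}_\phi)$. Then there are a polynomial $P(t)=nt^{n-1}+(\text{lower terms})\in\mathbb C[t]$ and $\gamma\in\mathbb C$ such that $A$ is isomorphic to $H(P,\gamma)$ as a filtered algebra, that is, by an algebra isomorphism that maps $A_d$ onto the degree $\le d$ part of $H(P,\gamma)$ for every $d\ge 0$. -/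

import Mathlib

open MvPolynomial in
/-- The bracket `{f, g}_φ` on `ℂ[X, Y, Z]` (with `X = X 0`, `Y = X 1`, `Z = X 2`): the unique
biderivation with `{X, Y}_φ = ∂φ/∂Z`, `{X, Z}_φ = -∂φ/∂Y`, `{Y, Z}_φ = ∂φ/∂X`. -/
noncomputable def poissonBracket (φ f g : MvPolynomial (Fin 3) ℂ) : MvPolynomial (Fin 3) ℂ :=
  (pderiv 0 f * pderiv 1 g - pderiv 1 f * pderiv 0 g) * pderiv 2 φ
    - (pderiv 0 f * pderiv 2 g - pderiv 2 f * pderiv 0 g) * pderiv 1 φ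
    + (pderiv 1 f * pderiv 2 g - pderiv 2 f * pderiv 1 g) * pderiv 0 φ

open MvPolynomial in
/-- `φ = X ^ n + X Y ^ 2 + Z ^ 2`. -/
noncomputable def typeDPoly (n : ℕ) : MvPolynomial (Fin 3) ℂ :=
  X 0 ^ n + X 0 * X 1 ^ 2 + X 2 ^ 2

/-- The degrees of `X`, `Y`, `Z`, for which `φ` is homogeneous of degree `4 n` and
`{·, ·}_φ` has degree `-2`. -/
def typeDWeight (n : ℕ) : Fin 3 → ℕ := ![4, 2 * n - 2, 2 * n]

section Graded

variable {A : Type*} [Ring A] [Algebra ℂ A]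

/-- The part `∑_{j < i} F j` of a filtration below index `i` (zero for `i = 0`). -/
def filtLT (F : ℕ → Submodule ℂ A) (i : ℕ) : Submodule ℂ A := ⨆ j, ⨆ _ : j < i, F j

/-- The component of degree `i` of the associated graded algebra. -/
abbrev GrPiece (F : ℕ → Submodule ℂ A) (i : ℕ) : Type _ :=
  F i ⧸ (filtLT F i).submoduleOf (F i)

/-- The class in degree `i` of the associated graded algebra of an element of `F i`. -/
def grClass (F : ℕ → Submodule ℂ A) (i : ℕ) : F i →ₗ[ℂ] GrPiece F i :=
  ((filtLT F i).submoduleOf (F i)).mkQ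

end Graded

/-- A noncommutative deformation structure on the associative algebra `A`: an exhaustive algebra
filtration `A_0 ⊆ A_1 ⊆ ⋯` together with an isomorphism of graded algebras
`gr A ≅ ℂ[X, Y, Z]` (where `X`, `Y`, `Z` have degrees `4`, `2 n - 2`, `2 n`), under which the
bracket on `gr A` that commutators in `A` induce is `{·, ·}_φ`, for `φ = X ^ n + X Y ^ 2 + Z ^ 2`. -/
structure NoncommDeformation (n : ℕ) (A : Type*) [Ring A] [Algebra ℂ A] where
  /-- the filtration -/
  filt : ℕ → Submodule ℂ A
  isRingFiltration : IsRingFiltration filt (filtLT filt)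
  exhaustive : ∀ a : A, ∃ i, a ∈ filt i
  /-- the isomorphism `gr A ≅ ℂ[X, Y, Z]`, degree by degree -/
  grEquiv : ∀ i, GrPiece filt i ≃ₗ[ℂ]
    MvPolynomial.weightedHomogeneousSubmodule ℂ (typeDWeight n) i
  grEquiv_one :
    (grEquiv 0 (grClass filt 0 ⟨1, isRingFiltration.one_mem⟩) : MvPolynomial (Fin 3) ℂ) = 1
  grEquiv_mul : ∀ (i j : ℕ) (a : filt i) (b : filt j),
    (grEquiv (i + j) (grClass filt (i + j)
        ⟨(a : A) * b, isRingFiltration.mul_mem a.2 b.2⟩) : MvPolynomial (Fin 3) ℂ)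
      = grEquiv i (grClass filt i a) * grEquiv j (grClass filt j b)
  /-- `[A_i, A_j] ⊆ A_{i + j - 2}` and `gr [a, b] = {gr a, gr b}_φ`. -/
  grEquiv_commutator : ∀ (i j k : ℕ), i + j = k + 2 → ∀ (a : filt i) (b : filt j),
    ∃ h : (a : A) * b - b * a ∈ filt k,
      (grEquiv k (grClass filt k ⟨(a : A) * b - b * a, h⟩) : MvPolynomial (Fin 3) ℂ)
        = poissonBracket (typeDPoly n)
            (grEquiv i (grClass filt i a)) (grEquiv j (grClass filt j b))

open FreeAlgebra in
/-- The defining relations of `H(P, γ)` on `U = ι 0`, `V = ι 1`, `W = ι 2`: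
`[U, V] = 2 W`, `[U, W] = -2 U V + 2 W + γ`, `[V, W] = V ^ 2 + P(U)`. -/
inductive HRel (P : Polynomial ℂ) (γ : ℂ) :
    FreeAlgebra ℂ (Fin 3) → FreeAlgebra ℂ (Fin 3) → Prop
  | uv : HRel P γ (ι ℂ 0 * ι ℂ 1 - ι ℂ 1 * ι ℂ 0) (2 * ι ℂ 2)
  | uw : HRel P γ (ι ℂ 0 * ι ℂ 2 - ι ℂ 2 * ι ℂ 0)
      (-2 * (ι ℂ 0 * ι ℂ 1) + 2 * ι ℂ 2 + algebraMap ℂ _ γ)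
  | vw : HRel P γ (ι ℂ 1 * ι ℂ 2 - ι ℂ 2 * ι ℂ 1)
      (ι ℂ 1 ^ 2 + Polynomial.aeval (ι ℂ 0) P)

/-- The algebra `H(P, γ)`. -/
abbrev HAlg (P : Polynomial ℂ) (γ : ℂ) : Type := RingQuot (HRel P γ)

/-- The generators `U`, `V`, `W` of `H(P, γ)`, for the indices `0`, `1`, `2`. -/
noncomputable def HAlg.gen (P : Polynomial ℂ) (γ : ℂ) (i : Fin 3) : HAlg P γ :=
  RingQuot.mkAlgHom ℂ (HRel P γ) (FreeAlgebra.ι ℂ i)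

/-- The filtration of `H(P, γ)` with `U`, `V`, `W` in degrees `4`, `2 n - 2`, `2 n`: degree `d` is
spanned by the monomials `U ^ i V ^ j W ^ k` with `4 i + (2 n - 2) j + 2 n k ≤ d`. -/
noncomputable def HAlg.filt (n : ℕ) (P : Polynomial ℂ) (γ : ℂ) (d : ℕ) :
    Submodule ℂ (HAlg P γ) :=
  Submodule.span ℂ {x | ∃ i j k : ℕ, 4 * i + (2 * n - 2) * j + 2 * n * k ≤ d ∧
    x = HAlg.gen P γ 0 ^ i * HAlg.gen P γ 1 ^ j * HAlg.gen P γ 2 ^ k}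

/-! Lift `X`, `Y` to `u`, `v` in `A` and put `w = [u, v] / 2`, which lifts `Z` because `{X, Y} =
2Z`. Since `gr A` is polynomial, the ordered monomials in `u`, `v`, `w` form a basis of `A` that
spans each filtration step (`filt_eq_orderedSpan`, `orderedEval_injective`). Hence `[u, w]` and `[v,
w]` are their leading terms plus corrections of lower weight, and few monomials fit. Shifting `u` by
a constant and `v` by a polynomial in `u` reduces the correction of `[u, w]` to `a w + γ`
(`exists_generators`). The Jacobi identity for `u`, `v`, `w` then forces `a = 2` and removes the `v`
and `w` terms from the correction of `[v, w]` (`exists_HRel_generators`). So `H(P, γ)` maps to `A`.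
Ordered monomials span `H(P, γ)` and have independent images that span `A`, so the map is bijective
and matches the filtrations. -/

open MvPolynomial

/-! ### Ordered monomials and reordering under the relations of `H(P, γ)` -/

section OrderedMonomials

variable {B : Type*} [Ring B] [Algebra ℂ B]

/-- The linear map that sends the monomial `X ^ i Y ^ j Z ^ k` to `u ^ i * v ^ j * w ^ k`. -/
noncomputable def orderedEval (u v w : B) : MvPolynomial (Fin 3) ℂ →ₗ[ℂ] B :=
  (basisMonomials (Fin 3) ℂ).constr ℂ fun m => u ^ m 0 * v ^ m 1 * w ^ m 2

theorem orderedEval_monomial (u v w : B) (m : Fin 3 →₀ ℕ) (c : ℂ) :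
    orderedEval u v w (monomial m c) = c • (u ^ m 0 * v ^ m 1 * w ^ m 2) := by
  have h : monomial m c = c • (basisMonomials (Fin 3) ℂ m) := by
    simp [smul_monomial]
  rw [h, map_smul, orderedEval, Module.Basis.constr_basis]

theorem orderedEval_X_pow (u v w : B) (i j k : ℕ) :
    orderedEval u v w (X 0 ^ i * X 1 ^ j * X 2 ^ k) = u ^ i * v ^ j * w ^ k := by
  have h : (X 0 ^ i * X 1 ^ j * X 2 ^ k : MvPolynomial (Fin 3) ℂ)
      = monomial (Finsupp.single 0 i + Finsupp.single 1 j + Finsupp.single 2 k) 1 := by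
    simp [X_pow_eq_monomial, monomial_mul]
  rw [h, orderedEval_monomial]
  simp

theorem orderedEval_aeval_mul (u v w : B) (p : Polynomial ℂ) (j k : ℕ) :
    orderedEval u v w (Polynomial.aeval (X 0) p * X 1 ^ j * X 2 ^ k)
      = Polynomial.aeval u p * v ^ j * w ^ k := by
  induction p using Polynomial.induction_on' with
  | add p q hp hq => simp only [map_add, add_mul, hp, hq]
  | monomial i c =>
    simp only [Polynomial.aeval_monomial, ← Algebra.smul_def, smul_mul_assoc, map_smul,
      orderedEval_X_pow]

/-- The span of the ordered monomials in `u`, `v`, `w` of weight at most `d`. -/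
def orderedSpan (n : ℕ) (u v w : B) (d : ℕ) : Submodule ℂ B :=
  Submodule.span ℂ {x | ∃ i j k : ℕ, 4 * i + (2 * n - 2) * j + 2 * n * k ≤ d ∧
    x = u ^ i * v ^ j * w ^ k}

variable {n : ℕ} {u v w : B}

theorem monomial_mem_orderedSpan {d : ℕ} (i j k : ℕ)
    (h : 4 * i + (2 * n - 2) * j + 2 * n * k ≤ d) :
    u ^ i * v ^ j * w ^ k ∈ orderedSpan n u v w d :=
  Submodule.subset_span ⟨i, j, k, h, rfl⟩

theorem orderedSpan_mono {d e : ℕ} (h : d ≤ e) :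
    orderedSpan n u v w d ≤ orderedSpan n u v w e := by
  refine Submodule.span_mono ?_
  rintro x ⟨i, j, k, hd, rfl⟩
  exact ⟨i, j, k, hd.trans h, rfl⟩

theorem orderedSpan_le_range_orderedEval (d : ℕ) :
    orderedSpan n u v w d ≤ LinearMap.range (orderedEval u v w) := by
  refine Submodule.span_le.2 ?_
  rintro x ⟨i, j, k, -, rfl⟩
  exact ⟨_, orderedEval_X_pow u v w i j k⟩

theorem mul_mem_of_monomial_mul_mem {y : B} {d : ℕ} {S : Submodule ℂ B}
    (h : ∀ i j k, 4 * i + (2 * n - 2) * j + 2 * n * k ≤ d → y * (u ^ i * v ^ j * w ^ k) ∈ S)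
    {x : B} (hx : x ∈ orderedSpan n u v w d) : y * x ∈ S := by
  have : orderedSpan n u v w d ≤ S.comap (LinearMap.mulLeft ℂ y) := by
    refine Submodule.span_le.2 ?_
    rintro x ⟨i, j, k, hd, rfl⟩
    exact h i j k hd
  exact this hx

theorem pow_mul_mem_orderedSpan {d e : ℕ} (i : ℕ) (h : 4 * i + d ≤ e) {x : B}
    (hx : x ∈ orderedSpan n u v w d) : u ^ i * x ∈ orderedSpan n u v w e := by
  refine mul_mem_of_monomial_mul_mem (fun i' j k hd => ?_) hx
  rw [← mul_assoc, ← mul_assoc, ← pow_add]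
  exact monomial_mem_orderedSpan _ _ _ (by omega)

theorem aeval_mul_mem_orderedSpan {d e : ℕ} (P : Polynomial ℂ) (h : 4 * P.natDegree + d ≤ e)
    {x : B} (hx : x ∈ orderedSpan n u v w d) :
    Polynomial.aeval u P * x ∈ orderedSpan n u v w e := by
  rw [Polynomial.aeval_eq_sum_range, Finset.sum_mul]
  refine Submodule.sum_mem _ fun i hi => ?_
  rw [smul_mul_assoc]
  refine Submodule.smul_mem _ _ (pow_mul_mem_orderedSpan i ?_ hx)
  have := Finset.mem_range.1 hi
  omega

/-- Left multiplication by `v` and `w` respects the weights of ordered monomials. -/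
theorem generator_mul_mem_orderedSpan {P : Polynomial ℂ} {γ : ℂ} (hn : 3 ≤ n)
    (hP : P.natDegree ≤ n - 1) (huv : u * v - v * u = 2 * w)
    (huw : u * w - w * u = -2 * (u * v) + 2 * w + algebraMap ℂ B γ)
    (hvw : v * w - w * v = v ^ 2 + Polynomial.aeval u P) (e : ℕ) :
    (∀ d, d + (2 * n - 2) ≤ e → ∀ x ∈ orderedSpan n u v w d, v * x ∈ orderedSpan n u v w e) ∧
    (∀ d, d + 2 * n ≤ e → ∀ x ∈ orderedSpan n u v w d, w * x ∈ orderedSpan n u v w e) := by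
  -- The two claims need each other: moving `v` past `u` creates `w`, and moving `w` past `u` or `v`
  -- creates `v`. The induction is on the target weight.
  induction e using Nat.strong_induction_on with
  | _ e ih =>
    have hvu : v * u = u * v - 2 * w := by rw [← huv]; abel
    have hwu : w * u = u * w + 2 * (u * v) - 2 * w - algebraMap ℂ B γ := by
      rw [sub_eq_iff_eq_add] at huw
      rw [huw]; noncomm_ring
    have hwv : w * v = v * w - v ^ 2 - Polynomial.aeval u P := by
      rw [sub_sub, ← hvw]; abel
    have two_mul_mem : ∀ {S : Submodule ℂ B} {x : B}, x ∈ S → 2 * x ∈ S := fun {S x} hx => by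
      rw [two_mul]; exact S.add_mem hx hx
    have hV : ∀ d, d + (2 * n - 2) ≤ e → ∀ x ∈ orderedSpan n u v w d,
        v * x ∈ orderedSpan n u v w e := by
      refine fun d hd x hx => mul_mem_of_monomial_mul_mem (fun i j k hm => ?_) hx
      cases i with
      | zero =>
        have : v * (u ^ 0 * v ^ j * w ^ k) = u ^ 0 * v ^ (j + 1) * w ^ k := by
          simp [pow_succ', mul_assoc]
        rw [this]
        exact monomial_mem_orderedSpan _ _ _ (by rw [mul_add]; omega)
      | succ i =>
        have hx' := monomial_mem_orderedSpan (u := u) (v := v) (w := w) (n := n)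
          (d := d - 4) i j k (by omega)
        set y := u ^ i * v ^ j * w ^ k
        have : v * (u ^ (i + 1) * v ^ j * w ^ k) = u ^ 1 * (v * y) - 2 * (w * y) := by
          rw [pow_succ', mul_assoc, mul_assoc, ← mul_assoc v, hvu]
          simp only [y]; noncomm_ring
        rw [this]
        refine Submodule.sub_mem _ ?_ (two_mul_mem ?_)
        · exact pow_mul_mem_orderedSpan 1 (d := e - 4) (by omega)
            ((ih (e - 4) (by omega)).1 _ (by omega) _ hx')
        · exact orderedSpan_mono (by omega) ((ih (e - 2) (by omega)).2 _ (by omega) _ hx')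
    refine ⟨hV, fun d hd x hx => mul_mem_of_monomial_mul_mem (fun i j k hm => ?_) hx⟩
    cases i with
    | zero =>
      cases j with
      | zero =>
        have : w * (u ^ 0 * v ^ 0 * w ^ k) = u ^ 0 * v ^ 0 * w ^ (k + 1) := by
          simp [pow_succ']
        rw [this]
        exact monomial_mem_orderedSpan _ _ _ (by rw [mul_add (2 * n)]; omega)
      | succ j =>
        rw [mul_add] at hm
        have hx' := monomial_mem_orderedSpan (u := u) (v := v) (w := w) (n := n)
          (d := d - (2 * n - 2)) 0 j k (by omega)
        set y := u ^ 0 * v ^ j * w ^ k with hy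
        have : w * (u ^ 0 * v ^ (j + 1) * w ^ k)
            = v * (w * y) - v * (v * y) - Polynomial.aeval u P * y := by
          rw [pow_succ', pow_zero, one_mul, mul_assoc, ← mul_assoc w, hwv]
          simp only [y]; noncomm_ring
        rw [this]
        refine Submodule.sub_mem _ (Submodule.sub_mem _ ?_ ?_) ?_
        -- The outer factor `v` is handled by `hV` at the same weight `e`, which is why `hV` is
        -- proved before the claim for `w`.
        · exact hV (e - (2 * n - 2)) (by omega) _
            ((ih (e - (2 * n - 2)) (by omega)).2 _ (by omega) _ hx')
        · exact hV (e - (2 * n - 2)) (by omega) _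
            ((ih (e - (2 * n - 2)) (by omega)).1 _ (by omega) _ hx')
        · exact aeval_mul_mem_orderedSpan P (by omega) hx'
    | succ i =>
      have hx' := monomial_mem_orderedSpan (u := u) (v := v) (w := w) (n := n)
        (d := d - 4) i j k (by omega)
      set y := u ^ i * v ^ j * w ^ k
      have : w * (u ^ (i + 1) * v ^ j * w ^ k)
          = u ^ 1 * (w * y) + 2 * (u ^ 1 * (v * y)) - 2 * (w * y) - γ • y := by
        rw [pow_succ', mul_assoc, mul_assoc, ← mul_assoc w, hwu, Algebra.smul_def]
        simp only [y]; noncomm_ring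
      rw [this]
      have hw := (ih (e - 4) (by omega)).2 _ (by omega) _ hx'
      have hv := (ih (e - 4) (by omega)).1 _ (by omega) _ hx'
      refine Submodule.sub_mem _ (Submodule.sub_mem _ (Submodule.add_mem _ ?_ (two_mul_mem ?_))
        (two_mul_mem ?_)) (Submodule.smul_mem _ _ ?_)
      · exact pow_mul_mem_orderedSpan 1 (by omega) hw
      · exact pow_mul_mem_orderedSpan 1 (by omega) hv
      · exact orderedSpan_mono (by omega) hw
      · exact orderedSpan_mono (by omega) hx'

end OrderedMonomials

/-! ### Spanning of `H(P, γ)` by ordered monomials -/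

section HAlg

variable {P : Polynomial ℂ} {γ : ℂ}

theorem HAlg.mkAlgHom_two : RingQuot.mkAlgHom ℂ (HRel P γ) 2 = 2 :=
  map_ofNat (RingQuot.mkAlgHom ℂ (HRel P γ)) 2

theorem HAlg.gen_uv : gen P γ 0 * gen P γ 1 - gen P γ 1 * gen P γ 0 = 2 * gen P γ 2 := by
  simpa [HAlg.gen, HAlg.mkAlgHom_two] using RingQuot.mkAlgHom_rel ℂ (HRel.uv (P := P) (γ := γ))

theorem HAlg.gen_uw : gen P γ 0 * gen P γ 2 - gen P γ 2 * gen P γ 0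
    = -2 * (gen P γ 0 * gen P γ 1) + 2 * gen P γ 2 + algebraMap ℂ _ γ := by
  have h := RingQuot.mkAlgHom_rel ℂ (HRel.uw (P := P) (γ := γ))
  simp only [map_sub, map_add, map_mul, map_neg, AlgHom.commutes, HAlg.mkAlgHom_two] at h
  exact h

theorem HAlg.gen_vw : gen P γ 1 * gen P γ 2 - gen P γ 2 * gen P γ 1
    = gen P γ 1 ^ 2 + Polynomial.aeval (gen P γ 0) P := by
  simpa [HAlg.gen, Polynomial.aeval_algHom_apply] using
    RingQuot.mkAlgHom_rel ℂ (HRel.vw (P := P) (γ := γ))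

theorem HAlg.adjoin_range_gen : Algebra.adjoin ℂ (Set.range (gen P γ)) = ⊤ := by
  have h : Set.range (gen P γ)
      = RingQuot.mkAlgHom ℂ (HRel P γ) '' Set.range (FreeAlgebra.ι ℂ) := by
    rw [← Set.range_comp]; rfl
  rw [h, Algebra.adjoin_image, FreeAlgebra.adjoin_range_ι, Algebra.map_top]
  exact (AlgHom.range_eq_top _).2 (RingQuot.mkAlgHom_surjective ℂ _)

/-- `H(P, γ)` is spanned by the ordered monomials in its generators. -/
theorem HAlg.orderedEval_surjective {n : ℕ} (hn : 3 ≤ n) (hP : P.natDegree ≤ n - 1) :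
    Function.Surjective (orderedEval (gen P γ 0) (gen P γ 1) (gen P γ 2)) := by
  -- The union of the spans is stable under left multiplication by the generators, hence by the
  -- whole algebra; it contains `1`.
  have key : ∀ a b : HAlg P γ, (∃ d, b ∈ orderedSpan n (gen P γ 0) (gen P γ 1) (gen P γ 2) d) →
      ∃ d, a * b ∈ orderedSpan n (gen P γ 0) (gen P γ 1) (gen P γ 2) d := by
    intro a
    have ha : a ∈ Algebra.adjoin ℂ (Set.range (gen P γ)) := by
      rw [adjoin_range_gen]; trivial
    induction ha using Algebra.adjoin_induction with
    | mem x hx =>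
      obtain ⟨i, rfl⟩ := hx
      rintro b ⟨d, hd⟩
      have h := fun e =>
        generator_mul_mem_orderedSpan hn hP (gen_uv (P := P) (γ := γ)) gen_uw gen_vw e
      fin_cases i
      · exact ⟨4 + d, by simpa using pow_mul_mem_orderedSpan 1 (by omega) hd⟩
      · exact ⟨d + (2 * n - 2), (h _).1 d le_rfl b hd⟩
      · exact ⟨d + 2 * n, (h _).2 d le_rfl b hd⟩
    | algebraMap r =>
      rintro b ⟨d, hd⟩
      exact ⟨d, by rw [← Algebra.smul_def]; exact Submodule.smul_mem _ _ hd⟩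
    | add x y _ _ hx hy =>
      intro b hb
      obtain ⟨d, hd⟩ := hx b hb
      obtain ⟨e, he⟩ := hy b hb
      exact ⟨max d e, by
        rw [add_mul]
        exact Submodule.add_mem _ (orderedSpan_mono (le_max_left d e) hd)
          (orderedSpan_mono (le_max_right d e) he)⟩
    | mul x y _ _ hx hy =>
      intro b hb
      rw [mul_assoc]
      exact hx _ (hy b hb)
  intro a
  obtain ⟨d, hd⟩ := key a 1 ⟨0, by
    simpa using monomial_mem_orderedSpan (n := n) (u := gen P γ 0) (v := gen P γ 1)
      (w := gen P γ 2) (d := 0) 0 0 0 (by simp)⟩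
  rw [mul_one] at hd
  exact orderedSpan_le_range_orderedEval d hd

end HAlg

/-! ### Symbols and the monomial basis of a deformation -/

theorem weight_typeDWeight (n : ℕ) (m : Fin 3 →₀ ℕ) :
    Finsupp.weight (typeDWeight n) m = 4 * m 0 + (2 * n - 2) * m 1 + 2 * n * m 2 := by
  rw [Finsupp.weight_apply, Finsupp.sum_fintype _ _ (by simp)]
  simp [Fin.sum_univ_three, typeDWeight]
  ring

namespace NoncommDeformation

variable {n : ℕ} {A : Type*} [Ring A] [Algebra ℂ A] (D : NoncommDeformation n A)

/-- `a` lies in degree `i` of the filtration, with class `f` in degree `i` of `gr A`. -/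
def HasSymbol (i : ℕ) (a : A) (f : MvPolynomial (Fin 3) ℂ) : Prop :=
  ∃ h : a ∈ D.filt i, (D.grEquiv i (grClass D.filt i ⟨a, h⟩) : MvPolynomial (Fin 3) ℂ) = f

variable {D}

theorem filt_mono {i j : ℕ} (h : i ≤ j) : D.filt i ≤ D.filt j :=
  D.isRingFiltration.mono h

theorem filtLT_le {i d : ℕ} (h : i ≤ d + 1) : filtLT D.filt i ≤ D.filt d :=
  iSup₂_le fun _ hj => filt_mono (by omega)

theorem filtLT_zero : filtLT D.filt 0 = ⊥ := by
  simp [filtLT]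

theorem hasSymbol_zero_of_mem {i j : ℕ} {a : A} (h : a ∈ D.filt j) (hj : j < i) :
    D.HasSymbol i a 0 := by
  refine ⟨filt_mono hj.le h, ?_⟩
  have : grClass D.filt i ⟨a, filt_mono hj.le h⟩ = 0 := by
    rw [grClass, Submodule.mkQ_apply, Submodule.Quotient.mk_eq_zero]
    exact D.isRingFiltration.is_le hj h
  rw [this]
  simp

theorem exists_hasSymbol {i : ℕ} {f : MvPolynomial (Fin 3) ℂ}
    (hf : IsWeightedHomogeneous (typeDWeight n) f i) : ∃ a, D.HasSymbol i a f := by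
  obtain ⟨a, ha⟩ := Submodule.mkQ_surjective _ ((D.grEquiv i).symm ⟨f, hf⟩)
  refine ⟨a, a.2, ?_⟩
  change (D.grEquiv i (Submodule.mkQ _ a) : MvPolynomial (Fin 3) ℂ) = f
  rw [ha]
  simp

namespace HasSymbol

variable {i j k : ℕ} {a b : A} {f g : MvPolynomial (Fin 3) ℂ}

theorem mem (h : D.HasSymbol i a f) : a ∈ D.filt i := h.1

theorem isWeightedHomogeneous (h : D.HasSymbol i a f) :
    IsWeightedHomogeneous (typeDWeight n) f i := by
  obtain ⟨h, rfl⟩ := h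
  exact (D.grEquiv i _).2

theorem eq (h : D.HasSymbol i a f) (h' : D.HasSymbol i a g) : f = g := by
  obtain ⟨_, rfl⟩ := h
  obtain ⟨_, rfl⟩ := h'
  rfl

theorem add (h : D.HasSymbol i a f) (h' : D.HasSymbol i b g) : D.HasSymbol i (a + b) (f + g) := by
  obtain ⟨ha, rfl⟩ := h
  obtain ⟨hb, rfl⟩ := h'
  refine ⟨Submodule.add_mem _ ha hb, ?_⟩
  rw [← Submodule.coe_add, ← map_add, ← map_add]
  rfl

theorem smul (c : ℂ) (h : D.HasSymbol i a f) : D.HasSymbol i (c • a) (c • f) := by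
  obtain ⟨ha, rfl⟩ := h
  refine ⟨Submodule.smul_mem _ c ha, ?_⟩
  rw [← Submodule.coe_smul, ← map_smul, ← map_smul]
  rfl

theorem sub (h : D.HasSymbol i a f) (h' : D.HasSymbol i b g) : D.HasSymbol i (a - b) (f - g) := by
  have := h.add (h'.smul (-1))
  simpa [sub_eq_add_neg] using this

theorem sum {ι : Type*} (s : Finset ι) {a : ι → A} {f : ι → MvPolynomial (Fin 3) ℂ}
    (h : ∀ x ∈ s, D.HasSymbol i (a x) (f x)) : D.HasSymbol i (∑ x ∈ s, a x) (∑ x ∈ s, f x) := by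
  classical
  induction s using Finset.induction_on with
  | empty =>
    refine ⟨zero_mem _, ?_⟩
    change (D.grEquiv i (grClass D.filt i 0) : MvPolynomial (Fin 3) ℂ) = 0
    simp
  | insert x s hx ih =>
    rw [Finset.sum_insert hx, Finset.sum_insert hx]
    exact (h x (by simp)).add (ih fun y hy => h y (by simp [hy]))

theorem mul (h : D.HasSymbol i a f) (h' : D.HasSymbol j b g) :
    D.HasSymbol (i + j) (a * b) (f * g) := by
  obtain ⟨ha, rfl⟩ := h
  obtain ⟨hb, rfl⟩ := h'
  exact ⟨_, D.grEquiv_mul i j ⟨a, ha⟩ ⟨b, hb⟩⟩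

theorem one : D.HasSymbol 0 1 1 := ⟨_, D.grEquiv_one⟩

theorem pow (h : D.HasSymbol i a f) (m : ℕ) : D.HasSymbol (i * m) (a ^ m) (f ^ m) := by
  induction m with
  | zero => simpa using one
  | succ m ih =>
    rw [pow_succ, pow_succ, mul_add, mul_one]
    exact ih.mul h

theorem commutator (h : D.HasSymbol i a f) (h' : D.HasSymbol j b g) (hk : i + j = k + 2) :
    D.HasSymbol k (a * b - b * a) (poissonBracket (typeDPoly n) f g) := by
  obtain ⟨ha, rfl⟩ := h
  obtain ⟨hb, rfl⟩ := h'
  exact D.grEquiv_commutator i j k hk ⟨a, ha⟩ ⟨b, hb⟩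

theorem mem_filtLT (h : D.HasSymbol i a 0) : a ∈ filtLT D.filt i := by
  obtain ⟨ha, h⟩ := h
  rw [Submodule.coe_eq_zero, LinearEquiv.map_eq_zero_iff, grClass, Submodule.mkQ_apply,
    Submodule.Quotient.mk_eq_zero] at h
  exact h

end HasSymbol

variable {u v w : A}

theorem hasSymbol_monomial (hu : D.HasSymbol 4 u (X 0)) (hv : D.HasSymbol (2 * n - 2) v (X 1))
    (hw : D.HasSymbol (2 * n) w (X 2)) (i j k : ℕ) :
    D.HasSymbol (4 * i + (2 * n - 2) * j + 2 * n * k) (u ^ i * v ^ j * w ^ k)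
      (X 0 ^ i * X 1 ^ j * X 2 ^ k) :=
  ((hu.pow i).mul (hv.pow j)).mul (hw.pow k)

theorem orderedSpan_le_filt (hu : D.HasSymbol 4 u (X 0)) (hv : D.HasSymbol (2 * n - 2) v (X 1))
    (hw : D.HasSymbol (2 * n) w (X 2)) (d : ℕ) : orderedSpan n u v w d ≤ D.filt d := by
  refine Submodule.span_le.2 ?_
  rintro x ⟨i, j, k, hd, rfl⟩
  exact filt_mono hd (hasSymbol_monomial hu hv hw i j k).mem

/-- Monomials of weight below `d` have class zero in degree `d`, so only the top component survives.
Allowing inhomogeneous `f` is what the independence proof needs. -/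
theorem hasSymbol_orderedEval (hu : D.HasSymbol 4 u (X 0))
    (hv : D.HasSymbol (2 * n - 2) v (X 1)) (hw : D.HasSymbol (2 * n) w (X 2)) {d : ℕ}
    {f : MvPolynomial (Fin 3) ℂ}
    (hf : ∀ m ∈ f.support, Finsupp.weight (typeDWeight n) m ≤ d) :
    D.HasSymbol d (orderedEval u v w f)
      (weightedHomogeneousComponent (typeDWeight n) d f) := by
  conv => arg 3; rw [f.as_sum]
  conv => arg 4; rw [f.as_sum]
  rw [map_sum, map_sum]
  refine HasSymbol.sum _ fun m hm => ?_
  have hX : monomial m (coeff m f) = coeff m f • (X 0 ^ m 0 * X 1 ^ m 1 * X 2 ^ m 2) := by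
    rw [monomial_eq, Finsupp.prod_fintype _ _ (by simp), Fin.prod_univ_three, smul_eq_C_mul]
  have hs := (hasSymbol_monomial hu hv hw (m 0) (m 1) (m 2)).smul (coeff m f)
  rw [← weight_typeDWeight, ← hX, ← orderedEval_monomial] at hs
  rcases (hf m hm).eq_or_lt with rfl | hlt
  · rwa [weightedHomogeneousComponent_eq_self]
    exact isWeightedHomogeneous_monomial _ _ _ rfl
  · rw [(isWeightedHomogeneous_monomial _ m _ rfl).weightedHomogeneousComponent_ne _ hlt.ne']
    exact hasSymbol_zero_of_mem hs.mem hlt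

/-- Subtracting the ordered evaluation of the symbol of `a` pushes `a` into a lower step, so
induction on the degree applies. -/
theorem filt_eq_orderedSpan (hu : D.HasSymbol 4 u (X 0)) (hv : D.HasSymbol (2 * n - 2) v (X 1))
    (hw : D.HasSymbol (2 * n) w (X 2)) (d : ℕ) : D.filt d = orderedSpan n u v w d := by
  refine le_antisymm ?_ (orderedSpan_le_filt hu hv hw d)
  induction d using Nat.strong_induction_on with
  | _ d ih =>
    intro a ha
    obtain ⟨f, hf⟩ : ∃ f, D.HasSymbol d a f := ⟨_, ha, rfl⟩
    have hhom := hf.isWeightedHomogeneous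
    have hsupp : ∀ m ∈ f.support, Finsupp.weight (typeDWeight n) m = d := fun m hm =>
      hhom (mem_support_iff.1 hm)
    have hΦ := hasSymbol_orderedEval hu hv hw fun m hm => (hsupp m hm).le
    rw [weightedHomogeneousComponent_eq_self hhom] at hΦ
    have hspan : orderedEval u v w f ∈ orderedSpan n u v w d := by
      rw [f.as_sum, map_sum]
      refine Submodule.sum_mem _ fun m hm => ?_
      rw [orderedEval_monomial]
      exact Submodule.smul_mem _ _ (monomial_mem_orderedSpan _ _ _
        ((weight_typeDWeight n m).symm.trans (hsupp m hm)).le)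
    have hlow := (hf.sub hΦ)
    rw [sub_self] at hlow
    have hlow := hlow.mem_filtLT
    have : a - orderedEval u v w f ∈ orderedSpan n u v w d := by
      cases d with
      | zero =>
        rw [filtLT_zero, Submodule.mem_bot] at hlow
        rw [hlow]
        exact zero_mem _
      | succ d => exact orderedSpan_mono d.le_succ (ih d d.lt_succ_self (filtLT_le le_rfl hlow))
    simpa using Submodule.add_mem _ this hspan

theorem orderedEval_injective (hu : D.HasSymbol 4 u (X 0))
    (hv : D.HasSymbol (2 * n - 2) v (X 1)) (hw : D.HasSymbol (2 * n) w (X 2)) :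
    Function.Injective (orderedEval u v w) := by
  rw [← LinearMap.ker_eq_bot, LinearMap.ker_eq_bot']
  intro f hf
  -- The component of weight `d` of `f` is the symbol of `0`, so any bound `d` on the weights in `f`
  -- is strict; this fails at the maximal weight.
  have hcomp : ∀ d, (∀ m ∈ f.support, Finsupp.weight (typeDWeight n) m ≤ d) →
      ∀ m ∈ f.support, Finsupp.weight (typeDWeight n) m < d := by
    intro d hd m hm
    refine (hd m hm).lt_of_ne fun hmd => mem_support_iff.1 hm ?_
    have h := hasSymbol_orderedEval hu hv hw hd
    rw [hf] at h
    have h0 : D.HasSymbol d 0 0 := by simpa using HasSymbol.sub h h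
    rw [← hmd] at h h0
    have := congrArg (coeff m) (h.eq h0)
    classical
    simpa [coeff_weightedHomogeneousComponent] using this
  by_contra hne
  obtain ⟨m, hm⟩ := support_nonempty.2 hne
  obtain ⟨m', hm', hmax⟩ := f.support.exists_max_image (Finsupp.weight (typeDWeight n)) ⟨m, hm⟩
  exact lt_irrefl _ (hcomp _ hmax m' hm')

theorem orderedEval_surjective (hu : D.HasSymbol 4 u (X 0))
    (hv : D.HasSymbol (2 * n - 2) v (X 1)) (hw : D.HasSymbol (2 * n) w (X 2)) :
    Function.Surjective (orderedEval u v w) := by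
  intro a
  obtain ⟨d, hd⟩ := D.exhaustive a
  rw [filt_eq_orderedSpan hu hv hw] at hd
  exact orderedSpan_le_range_orderedEval d hd

end NoncommDeformation

/-! ### Brackets of the coordinates -/

theorem poissonBracket_typeDPoly_X_Y (n : ℕ) :
    poissonBracket (typeDPoly n) (X 0) (X 1) = (2 : ℂ) • X 2 := by
  have h2 : (C 2 : MvPolynomial (Fin 3) ℂ) = 2 := map_ofNat C 2
  simp [poissonBracket, typeDPoly, pderiv_X, smul_eq_C_mul, h2]

theorem poissonBracket_typeDPoly_X_Z (n : ℕ) :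
    poissonBracket (typeDPoly n) (X 0) (X 2) = (-2 : ℂ) • (X 0 * X 1) := by
  have h2 : (C 2 : MvPolynomial (Fin 3) ℂ) = 2 := map_ofNat C 2
  simp [poissonBracket, typeDPoly, pderiv_X, smul_eq_C_mul, h2]
  ring

theorem poissonBracket_typeDPoly_Y_Z (n : ℕ) :
    poissonBracket (typeDPoly n) (X 1) (X 2) = X 1 ^ 2 + (n : ℂ) • X 0 ^ (n - 1) := by
  simp [poissonBracket, typeDPoly, pderiv_X, smul_eq_C_mul]
  ring

/-! ### Normal forms in low weight -/

section NormalForm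

variable {B : Type*} [Ring B] [Algebra ℂ B] {n : ℕ} {u v w : B}

/-- The bound is one below the weight `2n + 2` of `u v`, and `v ^ 2` has weight `4n - 4 ≥ 2n + 2`
because `n ≥ 3`. -/
theorem exists_eq_of_mem_orderedSpan_two_mul_add_one (hn : 3 ≤ n) {x : B}
    (hx : x ∈ orderedSpan n u v w (2 * n + 1)) :
    ∃ (a b : ℂ) (q : Polynomial ℂ), 2 * q.natDegree ≤ n ∧
      x = a • w + b • v + Polynomial.aeval u q := by
  rw [orderedSpan] at hx
  induction hx using Submodule.span_induction with
  | mem x hx =>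
    obtain ⟨i, j, k, hd, rfl⟩ := hx
    have hcases : (j = 0 ∧ k = 0 ∧ 2 * i ≤ n) ∨ (i = 0 ∧ j = 1 ∧ k = 0) ∨
        (i = 0 ∧ j = 0 ∧ k = 1) := by
      obtain rfl | rfl | hj : j = 0 ∨ j = 1 ∨ 2 ≤ j := by omega
      · obtain rfl | rfl | hk : k = 0 ∨ k = 1 ∨ 2 ≤ k := by omega
        · omega
        · omega
        · have := Nat.mul_le_mul_left (2 * n) hk
          omega
      · obtain rfl | hk : k = 0 ∨ 1 ≤ k := by omega
        · omega
        · have := Nat.mul_le_mul_left (2 * n) hk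
          omega
      · have := Nat.mul_le_mul_left (2 * n - 2) hj
        omega
    rcases hcases with ⟨rfl, rfl, hi⟩ | ⟨rfl, rfl, rfl⟩ | ⟨rfl, rfl, rfl⟩
    · exact ⟨0, 0, Polynomial.X ^ i, by simpa using hi, by simp⟩
    · exact ⟨0, 1, 0, by simp, by simp⟩
    · exact ⟨1, 0, 0, by simp, by simp⟩
  | zero => exact ⟨0, 0, 0, by simp, by simp⟩
  | add x y _ _ hx hy =>
    obtain ⟨a, b, q, hq, rfl⟩ := hx
    obtain ⟨a', b', q', hq', rfl⟩ := hy
    refine ⟨a + a', b + b', q + q', ?_, ?_⟩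
    · have := Polynomial.natDegree_add_le q q'
      omega
    · simp only [add_smul, map_add]; abel
  | smul c x _ hx =>
    obtain ⟨a, b, q, hq, rfl⟩ := hx
    refine ⟨c * a, c * b, c • q, ?_, ?_⟩
    · have := Polynomial.natDegree_smul_le c q
      omega
    · simp only [smul_add, mul_smul, map_smul]

/-- The bound is one below the weight `4n - 4` shared by `v ^ 2` and `u ^ (n - 1)`; hence at most
one factor `v` or `w` occurs, and `Q` cannot disturb the leading term of `P`. -/
theorem exists_eq_of_mem_orderedSpan_four_mul_sub_five (hn : 3 ≤ n) {x : B}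
    (hx : x ∈ orderedSpan n u v w (4 * n - 5)) :
    ∃ Q p r : Polynomial ℂ, Q.natDegree < n - 1 ∧
      x = Polynomial.aeval u Q + Polynomial.aeval u p * v + Polynomial.aeval u r * w := by
  rw [orderedSpan] at hx
  induction hx using Submodule.span_induction with
  | mem x hx =>
    obtain ⟨i, j, k, hd, rfl⟩ := hx
    have hcases : (j = 0 ∧ k = 0 ∧ i < n - 1) ∨ (j = 1 ∧ k = 0) ∨ (j = 0 ∧ k = 1) := by
      obtain rfl | rfl | hj : j = 0 ∨ j = 1 ∨ 2 ≤ j := by omega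
      · obtain rfl | rfl | hk : k = 0 ∨ k = 1 ∨ 2 ≤ k := by omega
        · omega
        · omega
        · have := Nat.mul_le_mul_left (2 * n) hk
          omega
      · obtain rfl | hk : k = 0 ∨ 1 ≤ k := by omega
        · omega
        · have := Nat.mul_le_mul_left (2 * n) hk
          omega
      · have := Nat.mul_le_mul_left (2 * n - 2) hj
        omega
    rcases hcases with ⟨rfl, rfl, hi⟩ | ⟨rfl, rfl⟩ | ⟨rfl, rfl⟩
    · exact ⟨Polynomial.X ^ i, 0, 0, by simpa using hi, by simp⟩
    · exact ⟨0, Polynomial.X ^ i, 0, by simp; omega, by simp⟩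
    · exact ⟨0, 0, Polynomial.X ^ i, by simp; omega, by simp⟩
  | zero => exact ⟨0, 0, 0, by simp; omega, by simp⟩
  | add x y _ _ hx hy =>
    obtain ⟨Q, p, r, hQ, rfl⟩ := hx
    obtain ⟨Q', p', r', hQ', rfl⟩ := hy
    refine ⟨Q + Q', p + p', r + r', ?_, ?_⟩
    · have := Polynomial.natDegree_add_le Q Q'
      omega
    · simp only [map_add, add_mul]; abel
  | smul c x _ hx =>
    obtain ⟨Q, p, r, hQ, rfl⟩ := hx
    refine ⟨c • Q, c • p, c • r, ?_, ?_⟩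
    · have := Polynomial.natDegree_smul_le c Q
      omega
    · simp only [smul_add, map_smul, smul_mul_assoc]

theorem eq_zero_of_orderedEval_injective (h : Function.Injective (orderedEval u v w))
    {p₀ p₁ p₂ : Polynomial ℂ} {c : ℂ}
    (h0 : Polynomial.aeval u p₀ + Polynomial.aeval u p₁ * v + Polynomial.aeval u p₂ * w
      + c • v ^ 2 = 0) : p₁ = 0 ∧ p₂ = 0 ∧ c = 0 := by
  have h00 := orderedEval_aeval_mul u v w p₀ 0 0
  have h10 := orderedEval_aeval_mul u v w p₁ 1 0
  have h01 := orderedEval_aeval_mul u v w p₂ 0 1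
  have h20 := orderedEval_aeval_mul u v w (Polynomial.C c) 2 0
  simp only [pow_zero, pow_one, mul_one, Polynomial.aeval_C, ← Algebra.smul_def]
    at h00 h10 h01 h20
  rw [← h00, ← h10, ← h01, ← h20, ← map_add, ← map_add, ← map_add,
    map_eq_zero_iff _ h] at h0
  have key : ∀ t y z : ℂ, p₀.eval t + p₁.eval t * y + p₂.eval t * z + c * y ^ 2 = 0 := by
    intro t y z
    have hev : ∀ p : Polynomial ℂ,
        MvPolynomial.eval ![t, y, z] (Polynomial.aeval (X 0) p) = p.eval t := fun p => by
      have := Polynomial.aeval_algHom_apply (MvPolynomial.aeval (R := ℂ) ![t, y, z]) (X 0) p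
      simpa [MvPolynomial.aeval_eq_eval] using this.symm
    have := congrArg (MvPolynomial.eval ![t, y, z]) h0
    simpa [hev, smul_eval] using this
  -- The values `y = 1, -1` separate the odd part in `y` from the even part.
  have hp₁ : ∀ t, p₁.eval t = 0 := fun t => by
    linear_combination (key t 1 0 - key t (-1) 0) / 2
  have hp₂ : ∀ t, p₂.eval t = 0 := fun t => by
    linear_combination key t 0 1 - key t 0 0
  refine ⟨Polynomial.funext fun t => by simpa using hp₁ t,
    Polynomial.funext fun t => by simpa using hp₂ t, ?_⟩
  linear_combination (key 0 1 0 + key 0 (-1) 0) / 2 - key 0 0 0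

end NormalForm

/-! ### Choice of generators and the Jacobi identity -/

namespace NoncommDeformation

variable {n : ℕ} {A : Type*} [Ring A] [Algebra ℂ A] {D : NoncommDeformation n A} {u v w : A}

theorem hasSymbol_of_commutator (hn : 3 ≤ n) (hu : D.HasSymbol 4 u (X 0))
    (hv : D.HasSymbol (2 * n - 2) v (X 1)) (huv : u * v - v * u = 2 * w) :
    D.HasSymbol (2 * n) w (X 2) := by
  have h := (hu.commutator hv (k := 2 * n) (by omega)).smul (2⁻¹ : ℂ)
  rw [poissonBracket_typeDPoly_X_Y, huv, smul_smul] at h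
  have h2 : (2 : A) * w = (2 : ℂ) • w := by rw [two_smul, two_mul]
  rw [h2, smul_smul] at h
  simpa using h

theorem exists_commutator_uw (hn : 3 ≤ n) (hu : D.HasSymbol 4 u (X 0))
    (hv : D.HasSymbol (2 * n - 2) v (X 1)) (hw : D.HasSymbol (2 * n) w (X 2)) :
    ∃ (a b : ℂ) (q : Polynomial ℂ), 2 * q.natDegree ≤ n ∧
      u * w - w * u = -2 * (u * v) + a • w + b • v + Polynomial.aeval u q := by
  have h := hu.commutator hw (k := 2 * n + 2) (by omega)
  have h' := (hu.mul hv).smul (-2)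
  rw [poissonBracket_typeDPoly_X_Z] at h
  rw [show 4 + (2 * n - 2) = 2 * n + 2 by omega] at h'
  have h0 := h.sub h'
  rw [sub_self] at h0
  have hmem := filtLT_le (d := 2 * n + 1) le_rfl h0.mem_filtLT
  rw [filt_eq_orderedSpan hu hv hw] at hmem
  obtain ⟨a, b, q, hq, heq⟩ := exists_eq_of_mem_orderedSpan_two_mul_add_one hn hmem
  refine ⟨a, b, q, hq, ?_⟩
  rw [sub_eq_iff_eq_add] at heq
  rw [heq, neg_smul, two_smul]
  noncomm_ring

theorem exists_commutator_vw (hn : 3 ≤ n) (hu : D.HasSymbol 4 u (X 0))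
    (hv : D.HasSymbol (2 * n - 2) v (X 1)) (hw : D.HasSymbol (2 * n) w (X 2)) :
    ∃ P p r : Polynomial ℂ, P.natDegree = n - 1 ∧ P.leadingCoeff = n ∧
      v * w - w * v = v ^ 2 + Polynomial.aeval u P + Polynomial.aeval u p * v
        + Polynomial.aeval u r * w := by
  have h := hv.commutator hw (k := 4 * n - 4) (by omega)
  have h₁ := hv.pow 2
  have h₂ := (hu.pow (n - 1)).smul (n : ℂ)
  rw [poissonBracket_typeDPoly_Y_Z] at h
  rw [show (2 * n - 2) * 2 = 4 * n - 4 by omega] at h₁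
  rw [show 4 * (n - 1) = 4 * n - 4 by omega] at h₂
  have h0 := h.sub (h₁.add h₂)
  rw [sub_self] at h0
  have hmem := filtLT_le (d := 4 * n - 5) (by omega) h0.mem_filtLT
  rw [filt_eq_orderedSpan hu hv hw] at hmem
  obtain ⟨Q, p, r, hQ, heq⟩ := exists_eq_of_mem_orderedSpan_four_mul_sub_five hn hmem
  have hn0 : (n : ℂ) ≠ 0 := by
    simp only [ne_eq, Nat.cast_eq_zero]; omega
  have hlead : (Polynomial.C (n : ℂ) * Polynomial.X ^ (n - 1)).natDegree = n - 1 :=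
    Polynomial.natDegree_C_mul_X_pow _ _ hn0
  refine ⟨Polynomial.C (n : ℂ) * Polynomial.X ^ (n - 1) + Q, p, r, ?_, ?_, ?_⟩
  · rw [Polynomial.natDegree_add_eq_left_of_natDegree_lt (by rwa [hlead]), hlead]
  · rw [Polynomial.leadingCoeff_add_of_degree_lt'
      (Polynomial.degree_lt_degree (by rwa [hlead])), Polynomial.leadingCoeff_C_mul_X_pow]
  · rw [sub_eq_iff_eq_add] at heq
    rw [heq, map_add, map_mul, Polynomial.aeval_C, ← Algebra.smul_def, map_pow,
      Polynomial.aeval_X]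
    abel

/-- The generators can be chosen so that `[u, w]` has no terms in `v` and no nonconstant
polynomial in `u`. -/
theorem exists_generators (hn : 3 ≤ n) (D : NoncommDeformation n A) :
    ∃ (u v w : A) (a γ : ℂ), D.HasSymbol 4 u (X 0) ∧ D.HasSymbol (2 * n - 2) v (X 1) ∧
      u * v - v * u = 2 * w ∧
      u * w - w * u = -2 * (u * v) + a • w + algebraMap ℂ A γ := by
  obtain ⟨u, hu⟩ := D.exists_hasSymbol (isWeightedHomogeneous_X ℂ (typeDWeight n) 0)
  obtain ⟨v, hv⟩ := D.exists_hasSymbol (isWeightedHomogeneous_X ℂ (typeDWeight n) 1)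
  change D.HasSymbol 4 u (X 0) at hu
  change D.HasSymbol (2 * n - 2) v (X 1) at hv
  obtain ⟨w, huv⟩ : ∃ w, u * v - v * u = 2 * w :=
    ⟨(2⁻¹ : ℂ) • (u * v - v * u), by rw [two_mul, ← add_smul]; norm_num⟩
  have hw := hasSymbol_of_commutator hn hu hv huv
  obtain ⟨a, b, q, hq, huw⟩ := exists_commutator_uw hn hu hv hw
  -- This shift absorbs the term in `v`: `-2 u v + b v = -2 (u - b/2) v`.
  set u' := u - algebraMap ℂ A (b / 2) with hu'
  set q' := q.comp (Polynomial.X + Polynomial.C (b / 2)) with hq'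
  -- Chosen so that `q' = -2 X s + q'(0)`; replacing `v` by `v + s(u')` then absorbs all but the
  -- constant term.
  set s := (-2⁻¹ : ℂ) • q'.divX with hs
  set v' := v + Polynomial.aeval u' s with hv'
  have hus : D.HasSymbol 4 u' (X 0) := by
    have h1 := D.hasSymbol_zero_of_mem (i := 4) ((HasSymbol.one (D := D)).smul (b / 2)).mem
      (by norm_num)
    rw [← Algebra.algebraMap_eq_smul_one] at h1
    simpa using hu.sub h1
  -- This gives `4 deg s ≤ 2n - 4 < 2n - 2`, so `v'` keeps the symbol `Y`.
  have hdeg : 2 * s.natDegree + 2 ≤ n := by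
    have h1 := Polynomial.natDegree_smul_le (-2⁻¹ : ℂ) q'.divX
    rw [← hs, Polynomial.natDegree_divX_eq_natDegree_tsub_one, hq', Polynomial.natDegree_comp] at h1
    simp only [Polynomial.natDegree_X_add_C, mul_one] at h1
    omega
  have hsmem : Polynomial.aeval u' s ∈ D.filt (4 * s.natDegree) := by
    rw [Polynomial.aeval_eq_sum_range]
    refine Submodule.sum_mem _ fun i hi => Submodule.smul_mem _ _ ?_
    have := Finset.mem_range.1 hi
    exact filt_mono (by omega) (hus.pow i).mem
  have hvs : D.HasSymbol (2 * n - 2) v' (X 1) := by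
    simpa using hv.add (hasSymbol_zero_of_mem hsmem (by omega))
  have hcomm : u' * Polynomial.aeval u' s = Polynomial.aeval u' s * u' := by
    have := congrArg (Polynomial.aeval u') (mul_comm Polynomial.X s)
    simpa using this
  have hq'u : Polynomial.aeval u' q' = Polynomial.aeval u q := by
    rw [hq', Polynomial.aeval_comp]
    simp [hu']
  have hsplit : Polynomial.aeval u q
      = -2 * (u' * Polynomial.aeval u' s) + algebraMap ℂ A (q'.coeff 0) := by
    rw [← hq'u]
    conv_lhs => rw [← Polynomial.divX_mul_X_add q']
    have hX : q'.divX * Polynomial.X = (-2 : ℂ) • (Polynomial.X * s) := by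
      rw [hs, mul_smul_comm, smul_smul, mul_comm]
      norm_num
    rw [hX, map_add, map_smul, map_mul, Polynomial.aeval_X, Polynomial.aeval_C, neg_smul, two_smul]
    noncomm_ring
  refine ⟨u', v', w, a, q'.coeff 0, hus, hvs, ?_, ?_⟩
  -- Constants are central and `s(u')` commutes with `u'`, so the commutator, and with it `w`, is
  -- unchanged.
  · rw [← huv, hv', mul_add, add_mul, hcomm, add_sub_add_right_eq_sub, hu', sub_mul, mul_sub,
      Algebra.commutes]
    abel
  · have h1 : u' * w - w * u' = u * w - w * u := by
      rw [hu', sub_mul, mul_sub, Algebra.commutes]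
      abel
    have h2 : b • v = 2 * (algebraMap ℂ A (b / 2) * v) := by
      rw [two_mul, ← Algebra.smul_def, ← add_smul, add_halves]
    have h3 : u = u' + algebraMap ℂ A (b / 2) := by simp [hu']
    rw [h1, huw, hsplit, hv', h2]
    conv_lhs => rw [h3]
    noncomm_ring

/-- The Jacobi identity determines the remaining structure constants. -/
theorem exists_HRel_generators (hn : 3 ≤ n) (D : NoncommDeformation n A) :
    ∃ (u v w : A) (P : Polynomial ℂ) (γ : ℂ), D.HasSymbol 4 u (X 0) ∧
      D.HasSymbol (2 * n - 2) v (X 1) ∧ D.HasSymbol (2 * n) w (X 2) ∧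
      P.natDegree = n - 1 ∧ P.leadingCoeff = n ∧
      u * v - v * u = 2 * w ∧
      u * w - w * u = -2 * (u * v) + 2 * w + algebraMap ℂ A γ ∧
      v * w - w * v = v ^ 2 + Polynomial.aeval u P := by
  obtain ⟨u, v, w, a, γ, hu, hv, huv, huw⟩ := exists_generators hn D
  have hw := hasSymbol_of_commutator hn hu hv huv
  obtain ⟨P, p, r, hdeg, hlead, hvw⟩ := exists_commutator_vw hn hu hv hw
  have hjac : u * (v * w - w * v) - (v * w - w * v) * u
      = v * (u * w - w * u) - (u * w - w * u) * v
        - (w * (u * v - v * u) - (u * v - v * u) * w) := by noncomm_ring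
  have hcomm : ∀ f : Polynomial ℂ, u * Polynomial.aeval u f = Polynomial.aeval u f * u := by
    intro f
    have := congrArg (Polynomial.aeval u) (mul_comm Polynomial.X f)
    simpa using this
  have hlhs : u * (v * w - w * v) - (v * w - w * v) * u
      = 2 * (w * v) + 2 * (v * w) + Polynomial.aeval u p * (2 * w)
        + Polynomial.aeval u r * (-2 * (u * v) + a • w + algebraMap ℂ A γ) := by
    rw [hvw, ← huw, ← huv]
    have h1 := hcomm P
    have h2 := hcomm p
    have h3 := hcomm r
    simp only [mul_add, add_mul, h1]
    rw [← mul_assoc u (Polynomial.aeval u p), h2, ← mul_assoc u (Polynomial.aeval u r), h3]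
    have h4 : u * v ^ 2 - v ^ 2 * u = 2 * (w * v) + 2 * (v * w) := by
      have : u * v ^ 2 - v ^ 2 * u = (u * v - v * u) * v + v * (u * v - v * u) := by
        noncomm_ring
      rw [this, huv]; noncomm_ring
    rw [← h4]
    noncomm_ring
  have hrhs : v * (u * w - w * u) - (u * w - w * u) * v
        - (w * (u * v - v * u) - (u * v - v * u) * w)
      = 4 * (w * v) + a • (v * w - w * v) := by
    have h1 : v * (-2 * (u * v)) - (-2 * (u * v)) * v = 4 * (w * v) := by
      have : v * (-2 * (u * v)) - (-2 * (u * v)) * v = 2 * ((u * v - v * u) * v) := by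
        noncomm_ring
      rw [this, huv]; noncomm_ring
    rw [huv, huw, mul_add, mul_add, add_mul, add_mul, ← Algebra.commutes γ v, ← h1, smul_sub,
      mul_smul_comm, smul_mul_assoc]
    noncomm_ring
  rw [hlhs, hrhs] at hjac
  -- The Jacobi identity in normal form, after `v w` is rewritten through `w v` so that the
  -- quadratic terms in `v` and `w` cancel.
  have hvan : Polynomial.aeval u ((2 - a) • P + γ • r)
      + Polynomial.aeval u ((2 - a) • p - (2 : ℂ) • (Polynomial.X * r)) * v
      + Polynomial.aeval u ((2 : ℂ) • r + (2 : ℂ) • p) * w + (2 - a) • v ^ 2 = 0 := by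
    have hvw' : v * w = w * v + (v ^ 2 + Polynomial.aeval u P + Polynomial.aeval u p * v
        + Polynomial.aeval u r * w) := by rw [← hvw]; abel
    rw [hvw, hvw', ← sub_eq_zero] at hjac
    rw [← hjac]
    simp only [map_add, map_sub, map_smul, map_mul, Polynomial.aeval_X, hcomm r, sub_smul,
      two_smul, add_mul, sub_mul, mul_add, smul_add, smul_mul_assoc, mul_smul_comm,
      ← Algebra.commutes γ, ← Algebra.smul_def]
    noncomm_ring
  -- The coefficient of `v ^ 2` gives `a = 2`; that of `v` becomes `-2 X r`, so `r = 0`; that of `w`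
  -- then gives `p = 0`.
  obtain ⟨hp₁, hp₂, ha⟩ := eq_zero_of_orderedEval_injective (orderedEval_injective hu hv hw) hvan
  have hr : r = 0 := by
    rw [ha] at hp₁
    simpa using hp₁
  have hp : p = 0 := by simpa [hr] using hp₂
  obtain rfl : a = 2 := (sub_eq_zero.1 ha).symm
  refine ⟨u, v, w, P, γ, hu, hv, hw, hdeg, hlead, huv, ?_, ?_⟩
  · rw [huw, two_smul, two_mul w]
  · rw [hvw, hp, hr]; simp

end NoncommDeformation

/-! ### Comparison of `H(P, γ)` with `A` -/

section Lift

variable {A : Type*} [Ring A] [Algebra ℂ A] {u v w : A} {P : Polynomial ℂ} {γ : ℂ}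

/-- The homomorphism `H(P, γ) → A` given by elements that satisfy the defining relations. -/
noncomputable def HAlg.lift (huv : u * v - v * u = 2 * w)
    (huw : u * w - w * u = -2 * (u * v) + 2 * w + algebraMap ℂ A γ)
    (hvw : v * w - w * v = v ^ 2 + Polynomial.aeval u P) : HAlg P γ →ₐ[ℂ] A :=
  RingQuot.liftAlgHom ℂ ⟨FreeAlgebra.lift ℂ ![u, v, w], by
    have h2 : FreeAlgebra.lift ℂ ![u, v, w] 2 = 2 := map_ofNat _ 2
    rintro x y (_ | _ | _)
    · simpa [h2] using huv
    · simpa [h2] using huw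
    · simpa [← Polynomial.aeval_algHom_apply] using hvw⟩

theorem HAlg.lift_gen (huv : u * v - v * u = 2 * w)
    (huw : u * w - w * u = -2 * (u * v) + 2 * w + algebraMap ℂ A γ)
    (hvw : v * w - w * v = v ^ 2 + Polynomial.aeval u P) (i : Fin 3) :
    HAlg.lift huv huw hvw (HAlg.gen P γ i) = ![u, v, w] i := by
  simp [HAlg.lift, HAlg.gen]

end Lift

theorem map_orderedSpan {B C : Type*} [Ring B] [Algebra ℂ B] [Ring C] [Algebra ℂ C]
    (f : B →ₐ[ℂ] C) (n : ℕ) (u v w : B) (d : ℕ) :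
    (orderedSpan n u v w d).map (f : B →ₗ[ℂ] C) = orderedSpan n (f u) (f v) (f w) d := by
  rw [orderedSpan, orderedSpan, Submodule.map_span]
  congr 1
  ext x
  constructor
  · rintro ⟨_, ⟨i, j, k, hd, rfl⟩, rfl⟩
    exact ⟨i, j, k, hd, by simp⟩
  · rintro ⟨i, j, k, hd, rfl⟩
    exact ⟨_, ⟨i, j, k, hd, rfl⟩, by simp⟩

theorem comp_orderedEval {B C : Type*} [Ring B] [Algebra ℂ B] [Ring C] [Algebra ℂ C]
    (f : B →ₐ[ℂ] C) (u v w : B) :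
    (f : B →ₗ[ℂ] C) ∘ₗ orderedEval u v w = orderedEval (f u) (f v) (f w) := by
  refine (basisMonomials (Fin 3) ℂ).ext fun m => ?_
  simp [orderedEval_monomial]

theorem mainTheorem8 (n : ℕ) (hn : 3 ≤ n) (A : Type*) [Ring A] [Algebra ℂ A]
    (D : NoncommDeformation n A) :
    ∃ (P : Polynomial ℂ) (γ : ℂ),
      P.natDegree = n - 1 ∧ P.leadingCoeff = (n : ℂ) ∧
        ∃ e : A ≃ₐ[ℂ] HAlg P γ, ∀ d : ℕ,
          (D.filt d).map (e : A →ₗ[ℂ] HAlg P γ) = HAlg.filt n P γ d := by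
  obtain ⟨u, v, w, P, γ, hu, hv, hw, hdeg, hlead, huv, huw, hvw⟩ := D.exists_HRel_generators hn
  refine ⟨P, γ, hdeg, hlead, ?_⟩
  have h0 : HAlg.lift huv huw hvw (HAlg.gen P γ 0) = u := HAlg.lift_gen huv huw hvw 0
  have h1 : HAlg.lift huv huw hvw (HAlg.gen P γ 1) = v := HAlg.lift_gen huv huw hvw 1
  have h2 : HAlg.lift huv huw hvw (HAlg.gen P γ 2) = w := HAlg.lift_gen huv huw hvw 2
  set Ψ := HAlg.lift huv huw hvw
  have hcomp : ∀ f, Ψ (orderedEval (HAlg.gen P γ 0) (HAlg.gen P γ 1) (HAlg.gen P γ 2) f)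
      = orderedEval u v w f := fun f => by
    have := LinearMap.congr_fun
      (comp_orderedEval Ψ (HAlg.gen P γ 0) (HAlg.gen P γ 1) (HAlg.gen P γ 2)) f
    rwa [h0, h1, h2] at this
  -- Spanning in `H(P, γ)` and independence in `A` suffice: no independence in `H(P, γ)` has to be
  -- known beforehand.
  have hinj : Function.Injective Ψ := by
    intro x y hxy
    obtain ⟨f, rfl⟩ := HAlg.orderedEval_surjective hn hdeg.le x
    obtain ⟨g, rfl⟩ := HAlg.orderedEval_surjective hn hdeg.le y
    rw [hcomp, hcomp] at hxy
    rw [NoncommDeformation.orderedEval_injective hu hv hw hxy]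
  have hsurj : Function.Surjective Ψ := fun a => by
    obtain ⟨f, rfl⟩ := NoncommDeformation.orderedEval_surjective hu hv hw a
    exact ⟨_, hcomp f⟩
  let e := AlgEquiv.ofBijective Ψ ⟨hinj, hsurj⟩
  refine ⟨e.symm, fun d => ?_⟩
  have hsymm : ∀ x, e.symm (Ψ x) = x := fun x => e.symm_apply_apply x
  have hmap := map_orderedSpan (e.symm : A →ₐ[ℂ] HAlg P γ) n u v w d
  rw [NoncommDeformation.filt_eq_orderedSpan hu hv hw]
  refine hmap.trans ?_
  rw [← h0, ← h1, ← h2, AlgEquiv.coe_toAlgHom, hsymm, hsymm, hsymm]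
  rfl
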